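/- Let $m\ge 2$ and let $(t_k)_{k\in\mathbb Z}$ be a nondecreasing, non-constant sequence of real knots; let $I$ be the convex hull of the set of knots. (A finite partition $x_0<\dots<x_n$ of a compact interval is included by setting $t_k=x_0$ for $k\le 0$, $t_k=x_k$ for $0\le k\le n$ and $t_k=x_n$ for $k\ge n$.) Let $B_j$ be the normalized B-spline of degree $m$ with support $[t_{j-m},t_{j+1}]$ (identically $0$ if $t_{j-m}=t_{j+1}$; if $I$ contains its right end point, the last knot interval of positive length is taken closed on the right). Put $$\theta_j=\frac1m\sum_{r=-m+1}^{0}t_{j+r},\qquad \theta_j^{(2)}=\binom m2^{-1}\sum_{-m+1\le r<s\le 0}t_{j+r}t_{j+s},\qquad A_j=\theta_j^2-\theta_j^{(2)},$$ $$\lambda_j(f)=f(\theta_j)-\tfrac12A_j\,f''(\theta_j),\qquad \mu_j(f)=f(\theta_j)-A_j\,[\theta_{j-1},\theta_j,\theta_{j+1}]f,\qquad Q_2^*f=\sum_{j\in\mathbb Z}\mu_j(f)B_j,$$ where $[\cdot,\cdot,\cdot]f$ is the second-order divided difference, and the second term of $\mu_j$ is omitted when $A_j=0$ (the three points $\theta_{j-1},\theta_j,\theta_{j+1}$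 are distinct whenever $A_j\ne0$). Then: (1) at every point of $I$ only finitely many $B_j$ are nonzero; (2) for every polynomial $p$ of degree at most $2$, $\mu_j(p)=\lambda_j(p)$ for all $j$, and $Q_2^*p=p$ on $I$; (3) $\|Q_2^*\|_\infty\le\left\lfloor\frac{m+4}{2}\right\rfloor$, where $\|Q\|_\infty=\sup\{\sup_I|Qf| : \sup_I|f|\le 1\}$. In particular the operators $Q_2^*$ are bounded uniformly with respect to the knots. -/

import Mathlib

open scoped ENNReal

noncomputable section

namespace SplineQI

/-- A knot sequence is a nondecreasing, non-constant bi-infinite sequence of reals.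
Infinite partitions of `ℝ` (or of any open interval) are the strictly increasing sequences.
A finite partition `x₀ < x₁ < ⋯ < xₙ` of a compact interval `[x₀, xₙ]`, with multiple knots at
the two ends, is the sequence with `t k = x₀` for `k ≤ 0`, `t k = x_k` for `0 ≤ k ≤ n` and
`t k = xₙ` for `k ≥ n`: all B-splines of degree `m` other than those of index `0, …, n + m - 1`
then vanish identically. -/
structure IsKnotSequence (t : ℤ → ℝ) : Prop where
  monotone : Monotone t
  nonconst : ∃ k l : ℤ, t k < t l

/-- The interval `I` that is partitioned by the knots: the convex hull of the set of knots.
An end point belongs to `I` exactly when it is a knot. -/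
def knotInterval (t : ℤ → ℝ) : Set ℝ := {x | ∃ k l : ℤ, t k ≤ x ∧ x ≤ t l}

open Classical in
/-- The Cox–de Boor recursion: `coxDeBoor t d i` is the normalized B-spline of degree `d` with
knots `t i, …, t (i + d + 1)`. In the recursion a quotient with zero denominator is `0`.
The functions of degree `0` are the indicators of `[t i, t (i + 1))`, except that the last
nondegenerate interval is closed on the right if the knots have a largest element. -/
def coxDeBoor (t : ℤ → ℝ) : ℕ → ℤ → ℝ → ℝ
  | 0, i, x =>
      if (t i ≤ x ∧ x < t (i + 1)) ∨ (t i < x ∧ x = t (i + 1) ∧ ∀ l : ℤ, t l ≤ x) then 1 else 0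
  | d + 1, i, x =>
      (x - t i) / (t (i + d + 1) - t i) * coxDeBoor t d i x
        + (t (i + d + 2) - x) / (t (i + d + 2) - t (i + 1)) * coxDeBoor t d (i + 1) x

/-- The B-spline `B_j` of degree `m`, with support `[t (j - m), t (j + 1)]`. -/
def bspline (m : ℕ) (t : ℤ → ℝ) (j : ℤ) (x : ℝ) : ℝ := coxDeBoor t m (j - m) x

/-- The index set `E_m = {-m + 1, …, 0}`. -/
def indexSet (m : ℕ) : Finset ℤ := Finset.Icc (-(m : ℤ) + 1) 0

/-- The Greville point `θ_j`: the mean of the knots `t (j - m + 1), …, t j`. -/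
def greville (m : ℕ) (t : ℤ → ℝ) (j : ℤ) : ℝ :=
  (∑ r ∈ indexSet m, t (j + r)) / m

/-- `θ_j^{(2)}`: the normalized second elementary symmetric function of the same knots. -/
def grevilleTwo (m : ℕ) (t : ℤ → ℝ) (j : ℤ) : ℝ :=
  (∑ s ∈ indexSet m, ∑ r ∈ indexSet m with r < s, t (j + r) * t (j + s)) / (m.choose 2 : ℝ)

/-- `A_j^{(2)} = θ_j ^ 2 - θ_j^{(2)}`. -/
def grevilleGap (m : ℕ) (t : ℤ → ℝ) (j : ℤ) : ℝ :=
  greville m t j ^ 2 - grevilleTwo m t j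

/-- The second-order divided difference `[x, y, z] f` (for pairwise distinct points). -/
def dividedDiffTwo (f : ℝ → ℝ) (x y z : ℝ) : ℝ := (slope f y z - slope f x y) / (z - x)

/-- The coefficient functional `λ_j^{(2)}` of the differential quasi-interpolant. -/
def diffCoeff (m : ℕ) (t : ℤ → ℝ) (j : ℤ) (f : ℝ → ℝ) : ℝ :=
  f (greville m t j) - 1 / 2 * grevilleGap m t j * iteratedDeriv 2 f (greville m t j)

/-- The coefficient functional `μ_j^{(2)}` of the discrete quasi-interpolant. If two of the three
Greville points coincide, the knots `t (j - m + 1), …, t j` coincide, so that `A_j^{(2)} = 0` and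
`μ_j^{(2)} f = f (θ_j)`. -/
def discreteCoeff (m : ℕ) (t : ℤ → ℝ) (j : ℤ) (f : ℝ → ℝ) : ℝ :=
  f (greville m t j) - grevilleGap m t j *
    dividedDiffTwo f (greville m t (j - 1)) (greville m t j) (greville m t (j + 1))

/-- The discrete quasi-interpolant `Q₂^* f = ∑ j, μ_j^{(2)}(f) B_j`. At each point of the interval
only finitely many B-splines are nonzero. -/
def discreteQI (m : ℕ) (t : ℤ → ℝ) (f : ℝ → ℝ) (x : ℝ) : ℝ :=
  ∑ᶠ j : ℤ, discreteCoeff m t j f * bspline m t j x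

/-- The sup norm of `f` on `I`, with values in `[0, ∞]`. -/
def supNormOn (I : Set ℝ) (f : ℝ → ℝ) : ℝ≥0∞ := ⨆ x ∈ I, ‖f x‖ₑ

/-- The norm `‖Q‖_∞` that the sup norm on `I` induces on an operator `Q`. All functions bounded
by `1` on `I` are admitted, in particular the continuous ones. -/
def opSupNorm (I : Set ℝ) (Q : (ℝ → ℝ) → ℝ → ℝ) : ℝ≥0∞ :=
  ⨆ (f : ℝ → ℝ) (_ : supNormOn I f ≤ 1), supNormOn I (Q f)

end SplineQI

end

/-! By Marsden's identity, the coefficient of `B_j` in the B-spline expansion of `x ^ r` is the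
normalized `r`-th elementary symmetric function of the knots `t (j - m + 1), …, t j`. For a
polynomial `p` of degree at most `2`, with coefficient `a` at `x ^ 2`, this gives
`p (θ_j) - a * A_j` as coefficient of `B_j`, which is both `λ_j p` and `μ_j p`.

As the B-splines are nonnegative and sum to `1`, it suffices to bound `μ_j f` for `|f| ≤ 1`. With
`u = θ_j - θ_{j-1}` and `v = θ_{j+1} - θ_j` one has `|μ_j f| ≤ 1 + 2 A_j / (u v)`. Up to a factor,
`A_j` is the variance of the knots `t (j - m + 1), …, t j`, so it is controlled by the square of
`w = t j - t (j - m + 1)`, while `u` and `v` are at least `w / m`. -/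

namespace SplineQI

open Finset
open scoped NNReal

section ScaledVariance

variable {ι : Type*} {s : Finset ι} {f : ι → ℝ} {a b : ℝ}

/-- `#s ^ 2` times the variance of the family `f` on `s`. For the `m` interior knots of a B-spline
it is `m ^ 2 * (m - 1)` times the gap `A_j`. -/
noncomputable def scaledVariance (s : Finset ι) (f : ι → ℝ) : ℝ :=
  #s * ∑ i ∈ s, f i ^ 2 - (∑ i ∈ s, f i) ^ 2

theorem scaledVariance_nonneg (s : Finset ι) (f : ι → ℝ) : 0 ≤ scaledVariance s f :=
  sub_nonneg.2 sq_sum_le_card_mul_sum_sq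

theorem convexOn_scaledVariance (s : Finset ι) : ConvexOn ℝ Set.univ (scaledVariance s) := by
  refine ⟨convex_univ, fun f _ g _ α β hα hβ hαβ => ?_⟩
  obtain rfl : β = 1 - α := by linarith
  have hsum_sq : ∑ i ∈ s, (α * f i + (1 - α) * g i) ^ 2 = α * ∑ i ∈ s, f i ^ 2 +
      (1 - α) * ∑ i ∈ s, g i ^ 2 - α * (1 - α) * ∑ i ∈ s, (f i - g i) ^ 2 := by
    simp only [mul_sum, ← sum_add_distrib, ← sum_sub_distrib]
    exact sum_congr rfl fun i _ => by ring
  have hdefect : scaledVariance s (α • f + (1 - α) • g) = α * scaledVariance s f +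
      (1 - α) * scaledVariance s g - α * (1 - α) * scaledVariance s (f - g) := by
    simp only [scaledVariance, Pi.add_apply, Pi.sub_apply, Pi.smul_apply, smul_eq_mul, hsum_sq]
    simp only [sum_add_distrib, sum_sub_distrib, ← mul_sum]
    ring
  rw [hdefect]
  exact sub_le_self _ (mul_nonneg (mul_nonneg hα hβ) (scaledVariance_nonneg s _))

theorem scaledVariance_of_forall_eq_or_eq (hf : ∀ i ∈ s, f i = a ∨ f i = b) :
    ∃ k l : ℕ, k + l = #s ∧ scaledVariance s f = (k * l : ℕ) * (b - a) ^ 2 := by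
  classical
  have hcard : #{i ∈ s | f i = a} + #{i ∈ s | f i ≠ a} = #s := card_filter_add_card_filter_not _
  have hsum (g : ℝ → ℝ) :
      ∑ i ∈ s, g (f i) = #{i ∈ s | f i = a} * g a + #{i ∈ s | f i ≠ a} * g b := by
    rw [← sum_filter_add_sum_filter_not s (f · = a), ← nsmul_eq_mul, ← nsmul_eq_mul,
      ← sum_const, ← sum_const]
    congr 1 <;> refine sum_congr rfl fun i hi => ?_ <;> rw [mem_filter] at hi
    · rw [hi.2]
    · rw [(hf i hi.1).resolve_left hi.2]
  refine ⟨_, _, hcard, ?_⟩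
  rw [scaledVariance, hsum fun y => y, hsum (· ^ 2), ← hcard]
  push_cast
  ring

/-- Popoviciu's inequality, sharp for both parities of `#s`: the left-hand side is convex in `f`,
hence largest at a vertex of the cube. -/
theorem scaledVariance_le (hf : ∀ i ∈ s, f i ∈ Set.Icc a b) :
    scaledVariance s f ≤ (#s ^ 2 / 4 : ℕ) * (b - a) ^ 2 := by
  have hcube : (fun i : s => f i) ∈ convexHull ℝ (Set.univ.pi fun _ => {a, b}) := by
    rw [convexHull_pi]
    intro i _
    have hi := hf i i.2
    rwa [convexHull_pair, segment_eq_Icc (hi.1.trans hi.2)]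
  obtain ⟨v, hv, hle⟩ :=
    (convexOn_scaledVariance univ).exists_ge_of_mem_convexHull (Set.subset_univ _) hcube
  obtain ⟨k, l, hkl, hvar⟩ := scaledVariance_of_forall_eq_or_eq fun i _ => hv i trivial
  have hprod : k * l ≤ #s ^ 2 / 4 := by
    rw [Nat.le_div_iff_mul_le four_pos, mul_comm, ← mul_assoc, ← Fintype.card_coe, ← card_univ,
      ← hkl]
    exact four_mul_le_sq_add k l
  calc scaledVariance s f = scaledVariance univ fun i : s => f i := by
        simp only [scaledVariance, univ_eq_attach, card_attach, sum_attach s f,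
          sum_attach s (f · ^ 2)]
    _ ≤ (k * l : ℕ) * (b - a) ^ 2 := hvar ▸ hle
    _ ≤ (#s ^ 2 / 4 : ℕ) * (b - a) ^ 2 := by gcongr

end ScaledVariance

section ElementarySymmetric

variable {ι R : Type*} [CommSemiring R]

theorem esymm_map_insert_succ [DecidableEq ι] {s : Finset ι} {a : ι} (ha : a ∉ s) (f : ι → R)
    (r : ℕ) : ((insert a s).val.map f).esymm (r + 1) =
      (s.val.map f).esymm (r + 1) + f a * (s.val.map f).esymm r := by
  rw [insert_val_of_notMem ha, Multiset.map_cons]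
  simp [Multiset.esymm, Multiset.powersetCard_cons, Multiset.sum_map_mul_left]

theorem esymm_map_zero (s : Finset ι) (f : ι → R) : (s.val.map f).esymm 0 = 1 := by
  simp [Finset.esymm_map_val]

theorem esymm_map_one (s : Finset ι) (f : ι → R) : (s.val.map f).esymm 1 = ∑ a ∈ s, f a := by
  simp [Finset.esymm_map_val, powersetCard_one]

theorem esymm_map_two [LinearOrder ι] (s : Finset ι) (f : ι → R) :
    (s.val.map f).esymm 2 = ∑ b ∈ s, ∑ a ∈ s with a < b, f a * f b := by
  induction s using Finset.induction_on_max with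
  | empty => simp [Multiset.esymm, Multiset.powersetCard_zero_right]
  | insert c s hc ih =>
    have hcs : c ∉ s := fun h => lt_irrefl c (hc c h)
    have hc_filter : {a ∈ insert c s | a < c} = s := by
      rw [filter_insert, if_neg (lt_irrefl c), filter_true_of_mem hc]
    have hs_filter (b : ι) (hb : b ∈ s) : {a ∈ insert c s | a < b} = {a ∈ s | a < b} := by
      rw [filter_insert, if_neg (hc b hb).not_gt]
    rw [esymm_map_insert_succ hcs, esymm_map_one, ih, sum_insert hcs, hc_filter, add_comm,
      ← sum_mul, mul_comm]
    congr 1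
    exact sum_congr rfl fun b hb => by rw [hs_filter b hb]

theorem two_mul_esymm_map_two {A : Type*} [CommRing A] (s : Finset ι) (f : ι → A) :
    2 * (s.val.map f).esymm 2 = (∑ a ∈ s, f a) ^ 2 - ∑ a ∈ s, f a ^ 2 := by
  classical
  induction s using Finset.induction_on with
  | empty => simp [Multiset.esymm, Multiset.powersetCard_zero_right]
  | insert c s hc ih =>
    rw [esymm_map_insert_succ hc, esymm_map_one, sum_insert hc, sum_insert hc, mul_add, ih]
    ring

end ElementarySymmetric

section DividedDifference

variable {f : ℝ → ℝ} {x y z M : ℝ}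

theorem dividedDiffTwo_eval {p : Polynomial ℝ} (hp : p.natDegree ≤ 2) (hxy : x ≠ y) (hyz : y ≠ z)
    (hxz : x ≠ z) : dividedDiffTwo (fun u => p.eval u) x y z = p.coeff 2 := by
  have hyx_sub : y - x ≠ 0 := sub_ne_zero.2 hxy.symm
  have hzy_sub : z - y ≠ 0 := sub_ne_zero.2 hyz.symm
  have hzx_sub : z - x ≠ 0 := sub_ne_zero.2 hxz.symm
  simp only [dividedDiffTwo, slope_def_field, Polynomial.eval_eq_sum_range' (Nat.lt_succ_of_le hp),
    sum_range_succ, sum_range_zero]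
  field_simp
  ring

theorem abs_slope_le (hx : |f x| ≤ M) (hy : |f y| ≤ M) (hxy : x < y) :
    |slope f x y| ≤ 2 * M / (y - x) := by
  have hsub : 0 < y - x := sub_pos.2 hxy
  rw [slope_def_field, abs_div, abs_of_pos hsub]
  gcongr
  linarith [abs_sub (f y) (f x)]

theorem abs_dividedDiffTwo_le (hx : |f x| ≤ M) (hy : |f y| ≤ M) (hz : |f z| ≤ M) (hxy : x < y)
    (hyz : y < z) : |dividedDiffTwo f x y z| ≤ 2 * M / ((y - x) * (z - y)) := by
  have hyx_sub : 0 < y - x := sub_pos.2 hxy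
  have hzy_sub : 0 < z - y := sub_pos.2 hyz
  have hzx_sub : 0 < z - x := sub_pos.2 (hxy.trans hyz)
  calc |dividedDiffTwo f x y z| = |slope f y z - slope f x y| / (z - x) := by
        rw [dividedDiffTwo, abs_div, abs_of_pos hzx_sub]
    _ ≤ (|slope f y z| + |slope f x y|) / (z - x) := by
        gcongr
        exact abs_sub _ _
    _ ≤ (2 * M / (z - y) + 2 * M / (y - x)) / (z - x) := by
        gcongr
        exacts [abs_slope_le hy hz hyz, abs_slope_le hx hy hxy]
    _ = 2 * M / ((y - x) * (z - y)) := by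
        field_simp
        ring

theorem iteratedDeriv_two_eval {p : Polynomial ℝ} (hp : p.natDegree ≤ 2) (x : ℝ) :
    iteratedDeriv 2 (fun u => p.eval u) x = 2 * p.coeff 2 := by
  have hderiv (q : Polynomial ℝ) : deriv (fun u => q.eval u) = fun u => q.derivative.eval u :=
    funext fun _ => q.deriv
  have hconst : p.derivative.derivative.natDegree ≤ 0 :=
    (p.derivative.natDegree_derivative_le.trans
      (Nat.sub_le_sub_right (p.natDegree_derivative_le.trans (Nat.sub_le_sub_right hp 1)) 1))
  rw [iteratedDeriv_succ, iteratedDeriv_one, hderiv, hderiv,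
    Polynomial.eq_C_of_natDegree_le_zero hconst]
  norm_num [Polynomial.coeff_derivative, mul_comm]

end DividedDifference

section KnotSpan

variable {t : ℤ → ℝ} {x : ℝ} {i k : ℤ}

theorem exists_and_not_add_one {P : ℤ → Prop} {a b : ℤ} (hab : a ≤ b) (ha : P a) (hb : ¬P b) :
    ∃ i, P i ∧ ¬P (i + 1) := by
  by_contra! hstep
  exact hb (Int.leInduction (m := a) (motive := fun n _ => P n) ha (fun n _ => hstep n) b hab)

/-- `x` lies in the knot interval `[t k, t (k + 1))`, the last nondegenerate one being closed on
the right: the condition under which the B-spline of degree `0` and index `k` is `1` at `x`. -/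
def IsKnotSpan (t : ℤ → ℝ) (x : ℝ) (k : ℤ) : Prop :=
  (t k ≤ x ∧ x < t (k + 1)) ∨ (t k < x ∧ x = t (k + 1) ∧ ∀ l : ℤ, t l ≤ x)

theorem IsKnotSpan.left_le (hk : IsKnotSpan t x k) : t k ≤ x :=
  hk.elim And.left fun h => h.1.le

theorem IsKnotSpan.le_right (hk : IsKnotSpan t x k) : x ≤ t (k + 1) :=
  hk.elim (fun h => h.2.le) fun h => h.2.1.le

theorem IsKnotSpan.left_lt_right (hk : IsKnotSpan t x k) : t k < t (k + 1) :=
  hk.elim (fun h => h.1.trans_lt h.2) fun h => h.1.trans_eq h.2.1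

theorem IsKnotSpan.index_le (ht : Monotone t) (hi : IsKnotSpan t x i) (hk : IsKnotSpan t x k) :
    i ≤ k := by
  by_contra! hki
  have hle : t (k + 1) ≤ t i := ht hki
  rcases hk with ⟨-, hxk⟩ | ⟨-, hxk, hmax⟩
  · exact (hxk.trans_le hle).not_ge hi.left_le
  · linarith [hmax (i + 1), hi.left_lt_right]

theorem IsKnotSpan.unique (ht : Monotone t) (hi : IsKnotSpan t x i) (hk : IsKnotSpan t x k) :
    i = k :=
  (hi.index_le ht hk).antisymm (hk.index_le ht hi)

theorem IsKnotSequence.exists_isKnotSpan (ht : IsKnotSequence t) (hx : x ∈ knotInterval t) :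
    ∃ k, IsKnotSpan t x k := by
  obtain ⟨a, b, ha, hb⟩ := hx
  by_cases hmax : ∀ l, t l ≤ x
  · obtain ⟨c, d, hcd⟩ := ht.nonconst
    have hc : t c < x := hcd.trans_le (hmax d)
    obtain ⟨k, hk, hk'⟩ := exists_and_not_add_one (P := (t · < x))
      (ht.monotone.reflect_lt (hc.trans_le hb)).le hc hb.not_gt
    exact ⟨k, .inr ⟨hk, (not_lt.1 hk').antisymm (hmax _), hmax⟩⟩
  · push Not at hmax
    obtain ⟨l, hl⟩ := hmax
    obtain ⟨k, hk, hk'⟩ := exists_and_not_add_one (P := (t · ≤ x))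
      (ht.monotone.reflect_lt (ha.trans_lt hl)).le ha hl.not_ge
    exact ⟨k, .inl ⟨hk, not_le.1 hk'⟩⟩

end KnotSpan

section BSpline

variable {t : ℤ → ℝ} {x : ℝ} {d : ℕ} {i : ℤ}

open Classical in
theorem coxDeBoor_zero (t : ℤ → ℝ) (k : ℤ) (x : ℝ) :
    coxDeBoor t 0 k x = if IsKnotSpan t x k then 1 else 0 := by
  rw [coxDeBoor]
  congr!

theorem exists_isKnotSpan_of_coxDeBoor_ne_zero (h : coxDeBoor t d i x ≠ 0) :
    ∃ k ∈ Icc i (i + d), IsKnotSpan t x k := by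
  induction d generalizing i with
  | zero =>
    classical
    rw [coxDeBoor_zero, ite_ne_right_iff] at h
    exact ⟨i, by simp, h.1⟩
  | succ d ih =>
    have hterm : coxDeBoor t d i x ≠ 0 ∨ coxDeBoor t d (i + 1) x ≠ 0 := by
      contrapose! h
      simp [coxDeBoor, h.1, h.2]
    obtain ⟨k, hk, hspan⟩ | ⟨k, hk, hspan⟩ := hterm.imp ih ih <;>
      refine ⟨k, ?_, hspan⟩ <;>
      rw [mem_Icc] at hk ⊢ <;>
      omega

theorem finite_coxDeBoor_ne_zero (ht : Monotone t) (d : ℕ) (x : ℝ) :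
    {i | coxDeBoor t d i x ≠ 0}.Finite := by
  rcases Set.eq_empty_or_nonempty {i | coxDeBoor t d i x ≠ 0} with hempty | ⟨i, hi⟩
  · exact hempty ▸ Set.finite_empty
  · obtain ⟨k, -, hk⟩ := exists_isKnotSpan_of_coxDeBoor_ne_zero hi
    refine (Set.finite_Icc (k - d) k).subset fun j hj => ?_
    obtain ⟨l, hl, hspan⟩ := exists_isKnotSpan_of_coxDeBoor_ne_zero hj
    rw [hspan.unique ht hk, mem_Icc] at hl
    exact ⟨by omega, hl.1⟩

theorem hasFiniteSupport_mul_coxDeBoor (ht : Monotone t) (d : ℕ) (x : ℝ) (c : ℤ → ℝ) :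
    Function.HasFiniteSupport fun i => c i * coxDeBoor t d i x :=
  (finite_coxDeBoor_ne_zero ht d x).subset fun _ => right_ne_zero_of_mul

theorem mem_Icc_of_coxDeBoor_ne_zero (ht : Monotone t) (h : coxDeBoor t d i x ≠ 0) :
    x ∈ Set.Icc (t i) (t (i + d + 1)) := by
  obtain ⟨k, hk, hspan⟩ := exists_isKnotSpan_of_coxDeBoor_ne_zero h
  rw [mem_Icc] at hk
  exact ⟨(ht hk.1).trans hspan.left_le, hspan.le_right.trans (ht (by omega))⟩

theorem lt_of_coxDeBoor_ne_zero (ht : Monotone t) (h : coxDeBoor t d i x ≠ 0) :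
    t i < t (i + d + 1) := by
  obtain ⟨k, hk, hspan⟩ := exists_isKnotSpan_of_coxDeBoor_ne_zero h
  rw [mem_Icc] at hk
  exact (ht hk.1).trans_lt (hspan.left_lt_right.trans_le (ht (by omega)))

theorem coxDeBoor_nonneg (ht : Monotone t) (d : ℕ) (i : ℤ) (x : ℝ) : 0 ≤ coxDeBoor t d i x := by
  induction d generalizing i with
  | zero =>
    rw [coxDeBoor_zero]
    split_ifs <;> norm_num
  | succ d ih =>
    have hterm (j : ℤ) : 0 ≤ (x - t j) * coxDeBoor t d j x ∧
        0 ≤ (t (j + d + 1) - x) * coxDeBoor t d j x := by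
      by_cases h : coxDeBoor t d j x = 0
      · simp [h]
      · obtain ⟨hleft, hright⟩ := mem_Icc_of_coxDeBoor_ne_zero ht h
        exact ⟨mul_nonneg (sub_nonneg.2 hleft) (ih j), mul_nonneg (sub_nonneg.2 hright) (ih j)⟩
    have hright := (hterm (i + 1)).2
    rw [show i + 1 + (d : ℤ) + 1 = i + d + 2 by ring] at hright
    rw [coxDeBoor, div_mul_eq_mul_div, div_mul_eq_mul_div]
    exact add_nonneg (div_nonneg (hterm i).1 (sub_nonneg.2 (ht (by omega))))
      (div_nonneg hright (sub_nonneg.2 (ht (by omega))))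

theorem finsum_mul_coxDeBoor_succ (ht : Monotone t) (d : ℕ) (x : ℝ) (c : ℤ → ℝ) :
    ∑ᶠ i, c i * coxDeBoor t (d + 1) i x =
      ∑ᶠ i, ((x - t i) * c i + (t (i + d + 1) - x) * c (i - 1)) / (t (i + d + 1) - t i) *
        coxDeBoor t d i x := by
  let left (i : ℤ) : ℝ := (x - t i) * c i / (t (i + d + 1) - t i) * coxDeBoor t d i x
  let right (i : ℤ) : ℝ :=
    (t (i + d + 1) - x) * c (i - 1) / (t (i + d + 1) - t i) * coxDeBoor t d i x
  have hleft : left.HasFiniteSupport := hasFiniteSupport_mul_coxDeBoor ht d x _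
  have hright : right.HasFiniteSupport := hasFiniteSupport_mul_coxDeBoor ht d x _
  have hsplit (i : ℤ) : c i * coxDeBoor t (d + 1) i x = left i + right (i + 1) := by
    simp only [left, right, coxDeBoor, add_sub_cancel_right,
      show i + 1 + (d : ℤ) + 1 = i + d + 2 by ring]
    ring
  calc ∑ᶠ i, c i * coxDeBoor t (d + 1) i x = ∑ᶠ i, left i + ∑ᶠ i, right (i + 1) := by
        rw [finsum_congr hsplit, finsum_add_distrib hleft
          (hright.preimage (add_left_injective (1 : ℤ)).injOn)]
    _ = ∑ᶠ i, left i + ∑ᶠ i, right i := by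
        rw [← finsum_comp_equiv (Equiv.addRight (1 : ℤ)) (f := right)]
        rfl
    _ = _ := by
        rw [← finsum_add_distrib hleft hright]
        exact finsum_congr fun i => by simp only [left, right]; ring

end BSpline

section Marsden

variable {t : ℤ → ℝ} {x : ℝ}

theorem finsum_mul_coxDeBoor_succ_of_forall_eq (ht : Monotone t) {d : ℕ} {c e : ℤ → ℝ}
    (hce : ∀ i, (x - t i) * c i + (t (i + d + 1) - x) * c (i - 1) =
      (t (i + d + 1) - t i) * e i) :
    ∑ᶠ i, c i * coxDeBoor t (d + 1) i x = ∑ᶠ i, e i * coxDeBoor t d i x := by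
  rw [finsum_mul_coxDeBoor_succ ht]
  refine finsum_congr fun i => ?_
  by_cases h : coxDeBoor t d i x = 0
  · simp [h]
  · rw [hce, mul_div_cancel_left₀ _ (sub_pos.2 (lt_of_coxDeBoor_ne_zero ht h)).ne']

theorem IsKnotSequence.finsum_coxDeBoor (ht : IsKnotSequence t) (hx : x ∈ knotInterval t) (d : ℕ) :
    ∑ᶠ i, coxDeBoor t d i x = 1 := by
  classical
  induction d with
  | zero =>
    obtain ⟨k, hk⟩ := ht.exists_isKnotSpan hx
    rw [finsum_eq_single _ k, coxDeBoor_zero, if_pos hk]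
    intro i hik
    rw [coxDeBoor_zero, if_neg fun hi => hik (hi.unique ht.monotone hk)]
  | succ d ih =>
    simpa [ih] using finsum_mul_coxDeBoor_succ_of_forall_eq (x := x) ht.monotone (d := d)
      (c := fun _ => 1) (e := fun _ => 1) fun _ => by ring

/-- Marsden's identity, in the form obtained by comparing coefficients of powers of `y` in
`(y - x) ^ d = ∑ i, (∏ k ∈ Ioc i (i + d), (y - t k)) * coxDeBoor t d i x`. -/
theorem IsKnotSequence.finsum_esymm_mul_coxDeBoor (ht : IsKnotSequence t)
    (hx : x ∈ knotInterval t) (d r : ℕ) :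
    ∑ᶠ i : ℤ, ((Ioc i (i + d)).val.map t).esymm r * coxDeBoor t d i x = d.choose r * x ^ r := by
  induction d generalizing r with
  | zero =>
    cases r with
    | zero =>
      simp only [esymm_map_zero, ht.finsum_coxDeBoor hx, one_mul, Nat.choose_self, Nat.cast_one,
        pow_zero]
    | succ r => simp [Multiset.esymm, Multiset.powersetCard_zero_right]
  | succ d ih =>
    cases r with
    | zero => simp [esymm_map_zero, ht.finsum_coxDeBoor hx]
    | succ r =>
      let e (r : ℕ) (i : ℤ) : ℝ := ((Ioc i (i + d)).val.map t).esymm r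
      have hinsert_right (i : ℤ) :
          Ioc i (i + (d + 1 : ℕ)) = insert (i + d + 1) (Ioc i (i + d)) := by
        rw [insert_Ioc_right_eq_Ioc_add_one (by omega), Nat.cast_succ, add_assoc]
      have hinsert_left (i : ℤ) :
          Ioc (i - 1) (i - 1 + (d + 1 : ℕ)) = insert i (Ioc i (i + d)) := by
        rw [insert_Ioc_left_eq_Ioc_sub_one (by omega), Nat.cast_succ, sub_add_add_cancel]
      calc _ = ∑ᶠ i, (e (r + 1) i + x * e r i) * coxDeBoor t d i x :=
            finsum_mul_coxDeBoor_succ_of_forall_eq ht.monotone fun i => by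
              rw [hinsert_right, hinsert_left, esymm_map_insert_succ (by simp),
                esymm_map_insert_succ (by simp)]
              simp only [e]
              ring
        _ = ∑ᶠ i, e (r + 1) i * coxDeBoor t d i x + x * ∑ᶠ i, e r i * coxDeBoor t d i x := by
            simp only [add_mul, mul_assoc]
            rw [mul_finsum, finsum_add_distrib (hasFiniteSupport_mul_coxDeBoor ht.monotone d x _)]
            simpa only [mul_assoc] using
              hasFiniteSupport_mul_coxDeBoor ht.monotone d x fun i => x * e r i
        _ = (d + 1).choose (r + 1) * x ^ (r + 1) := by
            rw [ih, ih, Nat.choose_succ_succ']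
            push_cast
            ring

theorem finsum_mul_bspline (m : ℕ) (t : ℤ → ℝ) (x : ℝ) (c : ℤ → ℝ) :
    ∑ᶠ j, c j * bspline m t j x = ∑ᶠ i, c (i + m) * coxDeBoor t m i x := by
  rw [← finsum_comp_equiv (Equiv.addRight (m : ℤ))]
  simp [bspline]

theorem bspline_nonneg (ht : Monotone t) (m : ℕ) (j : ℤ) (x : ℝ) : 0 ≤ bspline m t j x :=
  coxDeBoor_nonneg ht m _ x

theorem finite_bspline_ne_zero (ht : Monotone t) (m : ℕ) (x : ℝ) :
    {j | bspline m t j x ≠ 0}.Finite :=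
  (finite_coxDeBoor_ne_zero ht m x).preimage (sub_left_injective (b := (m : ℤ))).injOn

theorem hasFiniteSupport_mul_bspline (ht : Monotone t) (m : ℕ) (x : ℝ) (c : ℤ → ℝ) :
    Function.HasFiniteSupport fun j => c j * bspline m t j x :=
  (finite_bspline_ne_zero ht m x).subset fun _ => right_ne_zero_of_mul

theorem IsKnotSequence.finsum_bspline (ht : IsKnotSequence t) (hx : x ∈ knotInterval t) (m : ℕ) :
    ∑ᶠ j, bspline m t j x = 1 := by
  simpa [ht.finsum_coxDeBoor hx] using finsum_mul_bspline m t x fun _ => 1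

theorem IsKnotSequence.abs_finsum_mul_bspline_le (ht : IsKnotSequence t)
    (hx : x ∈ knotInterval t) (m : ℕ) {c : ℤ → ℝ} {C : ℝ} (hc : ∀ j, |c j| ≤ C) :
    |∑ᶠ j, c j * bspline m t j x| ≤ C := by
  let S := (finite_bspline_ne_zero ht.monotone m x).toFinset
  have hone : ∑ j ∈ S, bspline m t j x = 1 := by
    rw [← ht.finsum_bspline hx m]
    exact (finsum_eq_sum_of_support_subset _ fun j hj => by simpa [S] using hj).symm
  rw [finsum_eq_sum_of_support_subset (s := S) _
    fun j hj => by simpa [S] using right_ne_zero_of_mul hj]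
  calc |∑ j ∈ S, c j * bspline m t j x| ≤ ∑ j ∈ S, |c j| * bspline m t j x := by
        refine (abs_sum_le_sum_abs _ _).trans_eq (sum_congr rfl fun j _ => ?_)
        rw [abs_mul, abs_of_nonneg (bspline_nonneg ht.monotone m j x)]
    _ ≤ ∑ j ∈ S, C * bspline m t j x := by
        gcongr with j
        exacts [bspline_nonneg ht.monotone m j x, hc j]
    _ = C := by rw [← mul_sum, hone, mul_one]

/-- The normalized elementary symmetric functions `θ_j^{(r)}` of the knots `t (j - m + 1), …, t j`;
`greville` and `grevilleTwo` are the cases `r = 1` and `r = 2`. -/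
noncomputable def grevilleMoment (m : ℕ) (t : ℤ → ℝ) (r : ℕ) (j : ℤ) : ℝ :=
  ((Ioc (j - m) j).val.map t).esymm r / m.choose r

/-- The blossom (polar form) of a polynomial of degree at most `m`, evaluated at the knots
`t (j - m + 1), …, t j`: the coefficient of `B_j` in the B-spline expansion of `p`. -/
noncomputable def knotBlossom (m : ℕ) (t : ℤ → ℝ) (p : Polynomial ℝ) (j : ℤ) : ℝ :=
  p.sum fun r a => a * grevilleMoment m t r j

theorem IsKnotSequence.finsum_grevilleMoment_mul_bspline (ht : IsKnotSequence t)
    (hx : x ∈ knotInterval t) {m r : ℕ} (hr : r ≤ m) :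
    ∑ᶠ j, grevilleMoment m t r j * bspline m t j x = x ^ r := by
  have hchoose : (m.choose r : ℝ) ≠ 0 := by exact_mod_cast (Nat.choose_pos hr).ne'
  simp only [grevilleMoment, div_eq_inv_mul, mul_assoc]
  rw [← mul_finsum, finsum_mul_bspline]
  simp only [add_sub_cancel_right]
  rw [ht.finsum_esymm_mul_coxDeBoor hx, inv_mul_cancel_left₀ hchoose]

theorem IsKnotSequence.finsum_knotBlossom_mul_bspline (ht : IsKnotSequence t)
    (hx : x ∈ knotInterval t) {m : ℕ} {p : Polynomial ℝ} (hp : p.natDegree ≤ m) :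
    ∑ᶠ j, knotBlossom m t p j * bspline m t j x = p.eval x := by
  simp only [knotBlossom, Polynomial.sum_def, sum_mul, mul_assoc]
  rw [finsum_sum_comm, Polynomial.eval_eq_sum, Polynomial.sum_def]
  · refine sum_congr rfl fun r hr => ?_
    rw [← mul_finsum, ht.finsum_grevilleMoment_mul_bspline hx
      ((Polynomial.le_natDegree_of_mem_supp r hr).trans hp)]
  · intro r _
    simpa only [mul_assoc] using hasFiniteSupport_mul_bspline ht.monotone m x
      fun j => p.coeff r * grevilleMoment m t r j

end Marsden

section Greville

variable {t : ℤ → ℝ} {m : ℕ} {j : ℤ}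

theorem map_addLeftEmbedding_indexSet (m : ℕ) (j : ℤ) :
    (indexSet m).map (addLeftEmbedding j) = Ioc (j - m) j := by
  rw [indexSet, map_add_left_Icc]
  ext k
  simp only [mem_Icc, mem_Ioc]
  omega

theorem sum_indexSet (m : ℕ) (j : ℤ) (g : ℤ → ℝ) :
    ∑ r ∈ indexSet m, g (j + r) = ∑ k ∈ Ioc (j - m) j, g k := by
  rw [← map_addLeftEmbedding_indexSet, sum_map]
  rfl

theorem greville_eq (m : ℕ) (t : ℤ → ℝ) (j : ℤ) :
    greville m t j = (∑ k ∈ Ioc (j - m) j, t k) / m := by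
  rw [greville, sum_indexSet]

theorem greville_eq_grevilleMoment (m : ℕ) (t : ℤ → ℝ) (j : ℤ) :
    greville m t j = grevilleMoment m t 1 j := by
  rw [greville_eq, grevilleMoment, esymm_map_one, Nat.choose_one_right]

theorem grevilleTwo_eq_grevilleMoment (m : ℕ) (t : ℤ → ℝ) (j : ℤ) :
    grevilleTwo m t j = grevilleMoment m t 2 j := by
  rw [grevilleTwo, grevilleMoment, esymm_map_two, ← map_addLeftEmbedding_indexSet]
  simp [filter_map]

theorem grevilleGap_eq (hm : 2 ≤ m) (t : ℤ → ℝ) (j : ℤ) :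
    grevilleGap m t j = scaledVariance (Ioc (j - m) j) t / (m ^ 2 * (m - 1)) := by
  have hm_two : (2 : ℝ) ≤ m := by exact_mod_cast hm
  have hm_zero : (m : ℝ) ≠ 0 := by positivity
  have hm_one : (m : ℝ) - 1 ≠ 0 := by linarith
  have hcard : #(Ioc (j - m) j) = m := by simp
  rw [grevilleGap, greville_eq, grevilleTwo_eq_grevilleMoment, grevilleMoment, scaledVariance,
    hcard, Nat.cast_choose_two]
  field_simp
  linear_combination (-m : ℝ) * two_mul_esymm_map_two (Ioc (j - m) j) t

theorem grevilleGap_nonneg (hm : 2 ≤ m) (t : ℤ → ℝ) (j : ℤ) : 0 ≤ grevilleGap m t j := by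
  have hm_one : (1 : ℝ) ≤ m := by exact_mod_cast one_le_two.trans hm
  rw [grevilleGap_eq hm]
  exact div_nonneg (scaledVariance_nonneg _ t) (mul_nonneg (sq_nonneg _) (sub_nonneg.2 hm_one))

theorem greville_sub_greville_sub_one (m : ℕ) (t : ℤ → ℝ) (j : ℤ) :
    greville m t j - greville m t (j - 1) = (t j - t (j - m)) / m := by
  have hright : ∑ k ∈ Ioc (j - 1 - m) j, t k = t j + ∑ k ∈ Ioc (j - 1 - m) (j - 1), t k := by
    rw [← sum_insert (by simp), insert_Ioc_sub_one_right_eq_Ioc (by omega)]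
  have hleft : ∑ k ∈ Ioc (j - 1 - m) j, t k = t (j - m) + ∑ k ∈ Ioc (j - m) j, t k := by
    rw [← sum_insert (by simp), insert_Ioc_left_eq_Ioc_sub_one (by omega), sub_right_comm]
  rw [greville_eq, greville_eq, ← sub_div]
  congr 1
  linarith

theorem monotone_greville (ht : Monotone t) (m : ℕ) : Monotone (greville m t) :=
  monotone_int_of_le_succ fun j => by
    have hstep := greville_sub_greville_sub_one m t (j + 1)
    rw [add_sub_cancel_right] at hstep
    rw [← sub_nonneg, hstep]
    exact div_nonneg (sub_nonneg.2 (ht (by omega))) m.cast_nonneg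

theorem knot_mem_Icc (ht : Monotone t) {i j k : ℤ} (hk : k ∈ Ioc i j) :
    t k ∈ Set.Icc (t (i + 1)) (t j) :=
  ⟨ht (Int.add_one_le_of_lt (mem_Ioc.1 hk).1), ht (mem_Ioc.1 hk).2⟩

theorem greville_mem_Icc (ht : Monotone t) (hm : m ≠ 0) (j : ℤ) :
    greville m t j ∈ Set.Icc (t (j - m + 1)) (t j) := by
  have hm_pos : (0 : ℝ) < m := by positivity
  have hcard : #(Ioc (j - m) j) = m := by simp
  rw [greville_eq, Set.mem_Icc, le_div_iff₀' hm_pos, div_le_iff₀' hm_pos]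
  refine ⟨?_, ?_⟩
  · simpa [hcard] using card_nsmul_le_sum (Ioc (j - m) j) t _ fun k hk => (knot_mem_Icc ht hk).1
  · simpa [hcard] using sum_le_card_nsmul (Ioc (j - m) j) t _ fun k hk => (knot_mem_Icc ht hk).2

theorem greville_mem_knotInterval (ht : Monotone t) (hm : m ≠ 0) (j : ℤ) :
    greville m t j ∈ knotInterval t :=
  ⟨_, _, greville_mem_Icc ht hm j⟩

theorem two_mul_sq_div_four_le (m : ℕ) : 2 * (m ^ 2 / 4) ≤ (m + 2) / 2 * (m - 1) := by
  obtain ⟨n, rfl | rfl⟩ := m.even_or_odd'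
  · obtain _ | n := n
    · simp
    · rw [show (2 * (n + 1)) ^ 2 / 4 = (n + 1) ^ 2 by rw [mul_pow]; omega,
        show (2 * (n + 1) + 2) / 2 = n + 2 by omega,
        show 2 * (n + 1) - 1 = 2 * n + 1 by omega]
      nlinarith
  · rw [show (2 * n + 1) ^ 2 / 4 = n * (n + 1) by grind,
      show (2 * n + 1 + 2) / 2 = n + 1 by omega, Nat.add_sub_cancel]
    nlinarith

theorem two_mul_grevilleGap_le (ht : Monotone t) (hm : 2 ≤ m) (j : ℤ) :
    2 * grevilleGap m t j ≤ ((m + 2) / 2 : ℕ) *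
      ((greville m t j - greville m t (j - 1)) * (greville m t (j + 1) - greville m t j)) := by
  have hm_two : (2 : ℝ) ≤ m := by exact_mod_cast hm
  have hm_one : (0 : ℝ) < m - 1 := by linarith
  have hm_zero : (m : ℝ) ≠ 0 := by positivity
  have hcard : #(Ioc (j - m) j) = m := by simp
  have hvar : scaledVariance (Ioc (j - m) j) t ≤ (m ^ 2 / 4 : ℕ) * (t j - t (j - m + 1)) ^ 2 := by
    have h := scaledVariance_le fun k (hk : k ∈ Ioc (j - m) j) => knot_mem_Icc ht hk
    rwa [hcard] at h
  have hwidth : (t j - t (j - m + 1)) ^ 2 ≤ (t j - t (j - m)) * (t (j + 1) - t (j - m + 1)) := by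
    rw [sq]
    exact mul_le_mul (sub_le_sub_left (ht (by omega)) _) (sub_le_sub_right (ht (by omega)) _)
      (sub_nonneg.2 (ht (by omega))) (sub_nonneg.2 (ht (by omega)))
  have harith : 2 * ((m ^ 2 / 4 : ℕ) : ℝ) ≤ ((m + 2) / 2 : ℕ) * (m - 1) := by
    have h := two_mul_sq_div_four_le m
    rw [← Nat.cast_pred (by omega)]
    exact_mod_cast h
  have hspacing := greville_sub_greville_sub_one m t (j + 1)
  rw [add_sub_cancel_right, add_sub_right_comm] at hspacing
  rw [grevilleGap_eq hm, greville_sub_greville_sub_one, hspacing]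
  calc 2 * (scaledVariance (Ioc (j - m) j) t / (m ^ 2 * (m - 1)))
      ≤ 2 * ((m ^ 2 / 4 : ℕ) * (t j - t (j - m + 1)) ^ 2 / (m ^ 2 * (m - 1))) := by gcongr
    _ = 2 * (m ^ 2 / 4 : ℕ) * (t j - t (j - m + 1)) ^ 2 / (m ^ 2 * (m - 1)) := by ring
    _ ≤ ((m + 2) / 2 : ℕ) * (m - 1) * ((t j - t (j - m)) * (t (j + 1) - t (j - m + 1))) /
          (m ^ 2 * (m - 1)) := by gcongr
    _ = _ := by field_simp

theorem greville_lt_of_grevilleGap_ne_zero (ht : Monotone t) (hm : 2 ≤ m)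
    (h : grevilleGap m t j ≠ 0) :
    greville m t (j - 1) < greville m t j ∧ greville m t j < greville m t (j + 1) := by
  have hgap : 0 < grevilleGap m t j := (grevilleGap_nonneg hm t j).lt_of_ne' h
  have hprod := pos_of_mul_pos_right
    ((mul_pos two_pos hgap).trans_le (two_mul_grevilleGap_le ht hm j)) (Nat.cast_nonneg _)
  have hmono := monotone_greville ht m
  have hleft : greville m t (j - 1) ≤ greville m t j := hmono (by omega)
  have hright : greville m t j ≤ greville m t (j + 1) := hmono (by omega)
  exact ⟨hleft.lt_of_ne fun heq => by simp [heq] at hprod,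
    hright.lt_of_ne fun heq => by simp [heq] at hprod⟩

end Greville

section Coefficients

variable {t : ℤ → ℝ} {m : ℕ}

theorem knotBlossom_eq {p : Polynomial ℝ} (hp : p.natDegree ≤ 2) (m : ℕ) (t : ℤ → ℝ) (j : ℤ) :
    knotBlossom m t p j = p.eval (greville m t j) - grevilleGap m t j * p.coeff 2 := by
  have hp_lt : p.natDegree < 3 := Nat.lt_succ_of_le hp
  rw [knotBlossom, p.sum_over_range' (f := fun r a => a * grevilleMoment m t r j)
    (fun _ => zero_mul _) 3 hp_lt, p.eval_eq_sum_range' hp_lt]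
  simp only [sum_range_succ, range_zero, sum_empty, grevilleGap, grevilleTwo_eq_grevilleMoment,
    ← greville_eq_grevilleMoment]
  simp only [grevilleMoment, esymm_map_zero, Nat.choose_zero_right, Nat.cast_one]
  ring

theorem diffCoeff_eval {p : Polynomial ℝ} (hp : p.natDegree ≤ 2) (m : ℕ) (t : ℤ → ℝ) (j : ℤ) :
    diffCoeff m t j (fun x => p.eval x) = knotBlossom m t p j := by
  rw [diffCoeff, iteratedDeriv_two_eval hp, knotBlossom_eq hp]
  ring

theorem discreteCoeff_eval (ht : Monotone t) (hm : 2 ≤ m) {p : Polynomial ℝ}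
    (hp : p.natDegree ≤ 2) (j : ℤ) :
    discreteCoeff m t j (fun x => p.eval x) = knotBlossom m t p j := by
  rw [discreteCoeff, knotBlossom_eq hp]
  by_cases hgap : grevilleGap m t j = 0
  · simp [hgap]
  · obtain ⟨hleft, hright⟩ := greville_lt_of_grevilleGap_ne_zero ht hm hgap
    rw [dividedDiffTwo_eval hp hleft.ne hright.ne (hleft.trans hright).ne]

theorem abs_discreteCoeff_le (ht : Monotone t) (hm : 2 ≤ m) {f : ℝ → ℝ} {M : ℝ}
    (hf : ∀ x ∈ knotInterval t, |f x| ≤ M) (j : ℤ) :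
    |discreteCoeff m t j f| ≤ ((m + 4) / 2 : ℕ) * M := by
  have hbound (k : ℤ) : |f (greville m t k)| ≤ M :=
    hf _ (greville_mem_knotInterval ht (by omega) k)
  have hM : 0 ≤ M := (abs_nonneg _).trans (hbound j)
  have hfloor : (((m + 4) / 2 : ℕ) : ℝ) = 1 + ((m + 2) / 2 : ℕ) := by
    exact_mod_cast show (m + 4) / 2 = 1 + (m + 2) / 2 by omega
  suffices hsecond : |grevilleGap m t j * dividedDiffTwo f (greville m t (j - 1))
      (greville m t j) (greville m t (j + 1))| ≤ ((m + 2) / 2 : ℕ) * M by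
    rw [hfloor, one_add_mul]
    exact (abs_sub _ _).trans (add_le_add (hbound j) hsecond)
  by_cases hgap : grevilleGap m t j = 0
  · rw [hgap, zero_mul, abs_zero]
    positivity
  obtain ⟨hleft, hright⟩ := greville_lt_of_grevilleGap_ne_zero ht hm hgap
  have hprod : 0 < (greville m t j - greville m t (j - 1)) *
      (greville m t (j + 1) - greville m t j) := mul_pos (sub_pos.2 hleft) (sub_pos.2 hright)
  have hgap_nonneg := grevilleGap_nonneg hm t j
  calc _ ≤ grevilleGap m t j * (2 * M / ((greville m t j - greville m t (j - 1)) *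
        (greville m t (j + 1) - greville m t j))) := by
        rw [abs_mul, abs_of_nonneg hgap_nonneg]
        gcongr
        exact abs_dividedDiffTwo_le (hbound _) (hbound _) (hbound _) hleft hright
    _ = 2 * grevilleGap m t j * M / ((greville m t j - greville m t (j - 1)) *
        (greville m t (j + 1) - greville m t j)) := by ring
    _ ≤ ((m + 2) / 2 : ℕ) * M := by
        rw [div_le_iff₀ hprod, mul_right_comm _ M]
        exact mul_le_mul_of_nonneg_right (two_mul_grevilleGap_le ht hm j) hM

end Coefficients

theorem opSupNorm_le {I : Set ℝ} {Q : (ℝ → ℝ) → ℝ → ℝ} {C : ℝ≥0}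
    (h : ∀ f : ℝ → ℝ, (∀ x ∈ I, |f x| ≤ 1) → ∀ x ∈ I, |Q f x| ≤ C) : opSupNorm I Q ≤ C := by
  refine iSup₂_le fun f hf => iSup₂_le fun x hx => enorm_le_coe.2 (h f (fun y hy => ?_) x hx)
  exact enorm_le_coe.1 ((le_iSup₂ (f := fun x _ => ‖f x‖ₑ) y hy).trans hf)

end SplineQI

theorem theorem1 (m : ℕ) (hm : 2 ≤ m) (t : ℤ → ℝ) (ht : SplineQI.IsKnotSequence t) :
    (∀ x ∈ SplineQI.knotInterval t, {j : ℤ | SplineQI.bspline m t j x ≠ 0}.Finite) ∧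
    (∀ p : Polynomial ℝ, p.natDegree ≤ 2 →
      (∀ j : ℤ, SplineQI.discreteCoeff m t j (fun x => p.eval x) =
        SplineQI.diffCoeff m t j (fun x => p.eval x)) ∧
      ∀ x ∈ SplineQI.knotInterval t,
        SplineQI.discreteQI m t (fun y => p.eval y) x = p.eval x) ∧
    SplineQI.opSupNorm (SplineQI.knotInterval t) (SplineQI.discreteQI m t) ≤
      ((⌊((m : ℝ) + 4) / 2⌋₊ : ℕ) : ENNReal) := by
  have hfloor : ⌊((m : ℝ) + 4) / 2⌋₊ = (m + 4) / 2 := by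
    exact_mod_cast Nat.floor_div_eq_div (K := ℝ) (m + 4) 2
  refine ⟨fun x _ => SplineQI.finite_bspline_ne_zero ht.monotone m x, fun p hp => ⟨fun j => ?_,
    fun x hx => ?_⟩, ?_⟩
  · rw [SplineQI.discreteCoeff_eval ht.monotone hm hp, SplineQI.diffCoeff_eval hp]
  · simp only [SplineQI.discreteQI, SplineQI.discreteCoeff_eval ht.monotone hm hp]
    exact ht.finsum_knotBlossom_mul_bspline hx (hp.trans hm)
  · rw [hfloor]
    refine SplineQI.opSupNorm_le fun f hf x hx => ?_
    refine ht.abs_finsum_mul_bspline_le hx m fun j => ?_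
    simpa only [mul_one, NNReal.coe_natCast] using SplineQI.abs_discreteCoeff_le ht.monotone hm hf j
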